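/- Let $K\subset\mathbb{R}^2$ be a smooth, origin-symmetric planar convex body, that is, a compact strictly convex set with non-empty interior and $K=-K$ whose Gauss parametrization $x_K:\mathbb{S}^1\to\partial K$ (which sends $z=(\cos\theta,\sin\theta)$ to the boundary point with outer unit normal $z$) is a smooth embedding; equivalently, $\partial K$ is smooth with everywhere positive curvature. Let $s(\theta)=\max_{y\in K}\langle y,(\cos\theta,\sin\theta)\rangle$ be its support function, $\kappa(\theta)=\frac{1}{s''(\theta)+s(\theta)}$ the curvature of $\partial K$ as a function of the normal angle $\theta$, and $A(K)$ its area. For a real number $l$, let $$\Omega_l(K)=\int_0^{2\pi}\frac{s}{\kappa}\left(\frac{\kappa}{s^3}\right)^{\frac{l}{l+2}}d\theta$$ be the $l$-affine length of $\partial K$. Then, for every real $l\ge 1$, $$\frac{\Omega_l(K)^{2+l}}{A(K)^{2-l}}\le 2^{l+2}\pi^{2l},$$ with equality if and only if $K$ is an ellipse centered at the origin. -/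

import Mathlib

open scoped ContDiff RealInnerProductSpace

namespace CentroAffine

/-- The Euclidean plane. -/
abbrev Plane : Type := EuclideanSpace ℝ (Fin 2)

noncomputable section

/-- The unit vector `z = (cos θ, sin θ)`; the circle is identified with the normal angle `θ`. -/
def unitNormal (θ : ℝ) : Plane := !₂[Real.cos θ, Real.sin θ]

/-- `x` is the Gauss parametrization of the boundary of `K` by the normal angle: `x θ` is a
boundary point of `K` at which `(cos θ, sin θ)` is an outer normal vector. (There is exactly one
such point for every `θ` if `K` is compact and strictly convex, so `x` is then determined by `K`
and has period `2π`.) -/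
def IsGaussParametrization (K : Set Plane) (x : ℝ → Plane) : Prop :=
  ∀ θ, x θ ∈ frontier K ∧ ∀ y ∈ K, ⟪y, unitNormal θ⟫ ≤ ⟪x θ, unitNormal θ⟫

/-- The class of smooth origin-symmetric planar convex bodies: compact strictly convex sets with
interior points, symmetric about the origin, whose Gauss parametrization is a smooth embedding
of the circle (smooth, with nowhere vanishing derivative, and injective on a period). -/
structure IsSmoothSymmetricBody (K : Set Plane) : Prop where
  isCompact : IsCompact K
  strictConvex : StrictConvex ℝ K
  interior_nonempty : (interior K).Nonempty
  symmetric : ∀ y ∈ K, -y ∈ K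
  smoothly_embedded : ∃ x : ℝ → Plane, IsGaussParametrization K x ∧
    ContDiff ℝ ∞ x ∧ (∀ θ, deriv x θ ≠ 0) ∧ Set.InjOn x (Set.Ico 0 (2 * Real.pi))

/-- The support function `s` of `K`, as a function of the normal angle. -/
def supportFunction (K : Set Plane) (θ : ℝ) : ℝ :=
  sSup ((fun y : Plane => ⟪y, unitNormal θ⟫) '' K)

/-- The radius of curvature `𝔯 = s'' + s` of the boundary of `K`, as a function of the normal
angle. -/
def radiusOfCurvature (K : Set Plane) (θ : ℝ) : ℝ :=
  deriv (deriv (supportFunction K)) θ + supportFunction K θ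

/-- The curvature `κ = 1 / 𝔯` of the boundary of `K`, as a function of the normal angle. -/
def curvature (K : Set Plane) (θ : ℝ) : ℝ :=
  1 / radiusOfCurvature K θ

/-- The `l`-affine length `Ω_l(K) = ∫ (s / κ) (κ / s³)^(l / (l + 2)) dθ` over the circle. -/
def affineLength (l : ℝ) (K : Set Plane) : ℝ :=
  ∫ θ in (0 : ℝ)..(2 * Real.pi),
    supportFunction K θ / curvature K θ *
      (curvature K θ / supportFunction K θ ^ 3) ^ (l / (l + 2))

/-- The area of `K`. -/
def area (K : Set Plane) : ℝ := MeasureTheory.volume.real K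

/-- `K` is a (solid, nondegenerate) ellipse centered at the origin: the image of the closed unit
disk under an invertible linear map. -/
def IsCenteredEllipse (K : Set Plane) : Prop :=
  ∃ T : Plane ≃ₗ[ℝ] Plane, K = T '' Metric.closedBall 0 1

end

end CentroAffine

/-!
Write `s` for the support function, `𝔯 = s'' + s` for the radius of curvature, `A` for the area of
`K` and `p = l / (l + 2)`, which lies in `(0, 1)`. The integrand of the affine length equals
`(s 𝔯) ^ (1 - p) * (s⁻²) ^ p` (`affineLength_eq`), so Hölder's inequality
(`integral_rpow_mul_rpow_le`) gives
`Ω_l ≤ (∫ s 𝔯) ^ (1 - p) * (∫ s⁻²) ^ p = (2A) ^ (1 - p) * (∫ s⁻²) ^ p`,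
where `∫ s 𝔯 = 2A` is the classical area formula (`area_eq`). Raised to the power `l + 2` the right
hand side is `(2A)² (∫ s⁻²) ^ l`, and the bound follows from the Blaschke–Santaló inequality
`2A ∫ s⁻² ≤ 4π²` (`two_mul_area_mul_integral_inv_sq_le`).

The latter has a short proof in the plane. Since `∫ s 𝔯 = ∫ (s² - s'²)`, it is Wirtinger's inequality
`∫ |h|² ≤ ∫ |h'|²` for `h = s e^{iφ}`, where `φ' = (2π / ∫ s⁻²) s⁻²`; the symmetry of `K` makes `h`
antiperiodic with respect to `π`, so that `h` has mean zero.

The equality discussion needs only Hölder's inequality: equality means that `s 𝔯` is proportional to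
`s⁻²`, i.e. `s'' + s = c / s³`. This Ermakov equation forces `s²` to be a positive definite quadratic
form in `(cos θ, sin θ)`, which is the support function of an ellipse squared
(`isCenteredEllipse_of_radiusOfCurvature_mul`). Conversely an ellipse has `𝔯 s³ = (A / π)²`
(`radiusOfCurvature_mul_of_isCenteredEllipse`), which turns both inequalities into equalities.
-/

namespace CentroAffine

open MeasureTheory intervalIntegral

/-! ### Wirtinger's inequality and the Blaschke–Santaló inequality -/

/-- Wirtinger's inequality on the circle, by comparing the Fourier coefficients of `f` and `f'`. -/
theorem integral_norm_sq_le_of_integral_eq_zero {f f' : ℝ → ℂ}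
    (hf : ∀ θ, HasDerivAt f (f' θ) θ) (hf' : Continuous f')
    (hper : f (2 * Real.pi) = f 0) (hmean : ∫ θ in (0 : ℝ)..(2 * Real.pi), f θ = 0) :
    ∫ θ in (0 : ℝ)..(2 * Real.pi), ‖f θ‖ ^ 2 ≤ ∫ θ in (0 : ℝ)..(2 * Real.pi), ‖f' θ‖ ^ 2 := by
  have hπ : (0 : ℝ) < 2 * Real.pi := by positivity
  have hfc : Continuous f := continuous_iff_continuousAt.2 fun θ => (hf θ).continuousAt
  have memLp {g : ℝ → ℂ} (hg : Continuous g) :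
      MemLp g 2 (volume.restrict (Set.Ioc 0 (2 * Real.pi))) := by
    obtain ⟨C, hC⟩ := isCompact_Icc.exists_bound_of_continuousOn
      (hg.continuousOn (s := Set.Icc 0 (2 * Real.pi)))
    exact MemLp.of_bound hg.aestronglyMeasurable C
      ((ae_restrict_iff' measurableSet_Ioc).2
        (.of_forall fun x hx => hC x (Set.Ioc_subset_Icc_self hx)))
  have h1 := hasSum_sq_fourierCoeffOn hπ (memLp hfc)
  have h2 := hasSum_sq_fourierCoeffOn hπ (memLp hf')
  have key := hasSum_le (fun n : ℤ => ?_) h1 h2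
  · simp only [smul_eq_mul] at key
    exact le_of_mul_le_mul_left key (by simpa using hπ)
  · rcases eq_or_ne n 0 with rfl | hn
    · have : fourierCoeffOn hπ f 0 = 0 := by
        rw [fourierCoeffOn_eq_integral]
        simp [hmean]
      simp [this]
    · have hc := fourierCoeffOn_of_hasDerivAt hπ hn (fun x _ => hf x)
        (hf'.intervalIntegrable _ _)
      have hn1 : (1 : ℝ) ≤ |(n : ℝ)| := by exact_mod_cast Int.one_le_abs hn
      have : fourierCoeffOn hπ f' n = Complex.I * n * fourierCoeffOn hπ f n := by
        have hn' : (n : ℂ) ≠ 0 := by exact_mod_cast hn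
        have hpi : (Real.pi : ℂ) ≠ 0 := by exact_mod_cast Real.pi_ne_zero
        rw [hc, hper]
        push_cast
        field_simp
        ring_nf
      rw [this]
      have hnn : ‖fourierCoeffOn hπ f n‖ ≤ |(n : ℝ)| * ‖fourierCoeffOn hπ f n‖ :=
        le_mul_of_one_le_left (norm_nonneg _) hn1
      have : ‖Complex.I * n * fourierCoeffOn hπ f n‖ = |(n : ℝ)| * ‖fourierCoeffOn hπ f n‖ := by
        simp
      rw [this]
      gcongr

/-- The planar Blaschke–Santaló inequality in terms of the support function `s`. With
`L = ∫ s⁻²` and the phase `φ' = (2π / L) s⁻²`, the complex function `h = s e^{iφ}` changes sign under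
a shift by `π`, hence has mean zero, while `|h| = s` and `|h'|² = s'² + (2π / L)² s⁻²`. Wirtinger's
inequality for `h` reads `∫ (s² - s'²) ≤ 4π² / L`. -/
theorem integral_sq_sub_sq_mul_integral_inv_sq_le {s s' : ℝ → ℝ}
    (hs : ∀ θ, HasDerivAt s (s' θ) θ) (hs' : Continuous s') (hpos : ∀ θ, 0 < s θ)
    (hper : Function.Periodic s Real.pi) :
    (∫ θ in (0 : ℝ)..(2 * Real.pi), (s θ ^ 2 - s' θ ^ 2)) *
      ∫ θ in (0 : ℝ)..(2 * Real.pi), (s θ ^ 2)⁻¹ ≤ 4 * Real.pi ^ 2 := by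
  have hsc : Continuous s := continuous_iff_continuousAt.2 fun θ => (hs θ).continuousAt
  have hgc : Continuous fun θ => (s θ ^ 2)⁻¹ :=
    (hsc.pow 2).inv₀ fun θ => (pow_pos (hpos θ) 2).ne'
  have hgper : Function.Periodic (fun θ => (s θ ^ 2)⁻¹) Real.pi := fun θ => by simp [hper θ]
  have hgi (a b : ℝ) : IntervalIntegrable (fun θ => (s θ ^ 2)⁻¹) volume a b :=
    hgc.intervalIntegrable _ _
  set L := ∫ θ in (0 : ℝ)..(2 * Real.pi), (s θ ^ 2)⁻¹ with hL
  have hLpos : 0 < L := intervalIntegral_pos_of_pos (hgi _ _)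
    (fun θ => inv_pos.2 (pow_pos (hpos θ) 2)) (by positivity)
  set k := 2 * Real.pi / L with hk
  set φ : ℝ → ℝ := fun θ => k * ∫ τ in (0 : ℝ)..θ, (s τ ^ 2)⁻¹ with hφ
  have hφ' (θ : ℝ) : HasDerivAt φ (k * (s θ ^ 2)⁻¹) θ :=
    (hgc.integral_hasStrictDerivAt 0 θ).hasDerivAt.const_mul k
  have hφc : Continuous φ := continuous_iff_continuousAt.2 fun θ => (hφ' θ).continuousAt
  -- over half a period the phase advances by exactly `π`
  have hφπ (θ : ℝ) : φ (θ + Real.pi) = φ θ + Real.pi := by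
    have e1 := hgper.intervalIntegral_add_eq θ 0
    have e2 := hgper.intervalIntegral_add_eq Real.pi 0
    have e3 := integral_add_adjacent_intervals (hgi 0 Real.pi) (hgi Real.pi (Real.pi + Real.pi))
    have e4 := integral_add_adjacent_intervals (hgi 0 θ) (hgi θ (θ + Real.pi))
    have e5 : Real.pi + Real.pi = 2 * Real.pi := by ring
    rw [zero_add] at e1 e2
    rw [e2, e5, ← hL] at e3
    simp only [hφ]
    rw [← e4, e1, mul_add]
    congr 1
    have : ∫ τ in (0 : ℝ)..Real.pi, (s τ ^ 2)⁻¹ = L / 2 := by linarith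
    rw [this, hk]
    field_simp
  set h : ℝ → ℂ := fun θ => s θ * Complex.exp (φ θ * Complex.I) with hh
  set h' : ℝ → ℂ := fun θ => (s' θ + (k * (s θ)⁻¹ : ℝ) * Complex.I) *
    Complex.exp (φ θ * Complex.I) with hh'
  have hhd (θ : ℝ) : HasDerivAt h (h' θ) θ := by
    have := (hs θ).ofReal_comp.mul (((hφ' θ).ofReal_comp.mul_const Complex.I).cexp)
    refine this.congr_deriv ?_
    have h0 : (s θ : ℂ) ≠ 0 := by exact_mod_cast (hpos θ).ne'
    simp only [hh']
    push_cast
    field_simp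
  have hhc : Continuous h' := by
    have h1 : Continuous fun θ => k * (s θ)⁻¹ :=
      continuous_const.mul (hsc.inv₀ fun θ => (hpos θ).ne')
    simp only [hh']
    fun_prop
  have hhπ (θ : ℝ) : h (θ + Real.pi) = -h θ := by
    simp only [hh, hper θ, hφπ θ]
    push_cast
    rw [add_mul, Complex.exp_add, Complex.exp_pi_mul_I]
    ring
  have hcont : Continuous h := continuous_iff_continuousAt.2 fun θ => (hhd θ).continuousAt
  have hmean : ∫ θ in (0 : ℝ)..(2 * Real.pi), h θ = 0 := by
    rw [← integral_add_adjacent_intervals (hcont.intervalIntegrable 0 Real.pi)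
      (hcont.intervalIntegrable Real.pi (2 * Real.pi))]
    have : ∫ θ in (0 : ℝ)..Real.pi, h (θ + Real.pi) =
        ∫ θ in (0 + Real.pi)..(Real.pi + Real.pi), h θ :=
      integral_comp_add_right h Real.pi
    rw [zero_add, ← two_mul] at this
    rw [← this]
    simp [hhπ]
  have hend : h (2 * Real.pi) = h 0 := by
    have e1 := hhπ 0
    have e2 := hhπ Real.pi
    rw [zero_add] at e1
    rw [two_mul, e2, e1, neg_neg]
  have key := integral_norm_sq_le_of_integral_eq_zero hhd hhc hend hmean
  have n1 (θ : ℝ) : ‖h θ‖ ^ 2 = s θ ^ 2 := by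
    simp [hh, Complex.norm_exp_ofReal_mul_I]
  have n2 (θ : ℝ) : ‖h' θ‖ ^ 2 = s' θ ^ 2 + k ^ 2 * (s θ ^ 2)⁻¹ := by
    simp only [hh', norm_mul, Complex.norm_exp_ofReal_mul_I, mul_one]
    rw [← Complex.normSq_eq_norm_sq, Complex.normSq_add_mul_I, mul_pow, inv_pow]
  simp only [n1, n2] at key
  rw [integral_add (f := fun θ => s' θ ^ 2) ((hs'.pow 2).intervalIntegrable _ _)
      ((hgi _ _).const_mul _),
    intervalIntegral.integral_const_mul, ← hL] at key
  rw [integral_sub (f := fun θ => s θ ^ 2) (g := fun θ => s' θ ^ 2)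
    ((hsc.pow 2).intervalIntegrable _ _) ((hs'.pow 2).intervalIntegrable _ _)]
  have hkL : k ^ 2 * L * L = 4 * Real.pi ^ 2 := by
    rw [hk]; field_simp; norm_num
  calc _ ≤ (k ^ 2 * L) * L := by gcongr; linarith
    _ = _ := hkL

theorem integral_mul_add_eq_integral_sq_sub_sq {s s' s'' : ℝ → ℝ}
    (hs : ∀ θ, HasDerivAt s (s' θ) θ) (hs' : ∀ θ, HasDerivAt s' (s'' θ) θ)
    (hs'' : Continuous s'') {T : ℝ} (h0 : s T = s 0) (h1 : s' T = s' 0) :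
    ∫ θ in (0 : ℝ)..T, s θ * (s'' θ + s θ) = ∫ θ in (0 : ℝ)..T, (s θ ^ 2 - s' θ ^ 2) := by
  have hsc : Continuous s := continuous_iff_continuousAt.2 fun θ => (hs θ).continuousAt
  have hsc' : Continuous s' := continuous_iff_continuousAt.2 fun θ => (hs' θ).continuousAt
  have h := integral_eq_sub_of_hasDerivAt (f := fun θ => s θ * s' θ) (a := 0) (b := T)
    (fun θ _ => (hs θ).mul (hs' θ))
    ((by fun_prop : Continuous fun θ => s' θ * s' θ + s θ * s'' θ).intervalIntegrable _ _)
  rw [h0, h1, sub_self] at h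
  rw [← sub_eq_zero, ← integral_sub
    ((by fun_prop : Continuous fun θ => s θ * (s'' θ + s θ)).intervalIntegrable _ _)
    ((by fun_prop : Continuous fun θ => s θ ^ 2 - s' θ ^ 2).intervalIntegrable _ _), ← h]
  congr 1
  ext θ
  ring

/-! ### Hölder's inequality with its equality case -/

/-- Strict weighted inequality between the geometric and the arithmetic mean. -/
theorem rpow_mul_rpow_lt_of_ne {p u v : ℝ} (hp0 : 0 < p) (hp1 : p < 1) (hu : 0 < u) (hv : 0 < v)
    (huv : u ≠ v) : u ^ (1 - p) * v ^ p < (1 - p) * u + p * v := by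
  have h := strictConcaveOn_log_Ioi.2 hu hv huv (sub_pos.2 hp1) hp0 (by ring)
  simp only [smul_eq_mul] at h
  rw [Real.rpow_def_of_pos hu, Real.rpow_def_of_pos hv, ← Real.exp_add]
  have hpos : 0 < (1 - p) * u + p * v :=
    add_pos (mul_pos (sub_pos.2 hp1) hu) (mul_pos hp0 hv)
  rw [← Real.lt_log_iff_exp_lt hpos]
  linarith

/-- Hölder's inequality for positive continuous functions together with its equality case:
integrate the weighted inequality of means for the normalized functions `F / ∫ F` and `G / ∫ G`. -/
theorem integral_rpow_mul_rpow_le {p a b : ℝ} (hp0 : 0 < p) (hp1 : p < 1) (hab : a < b)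
    {F G : ℝ → ℝ} (hF : Continuous F) (hG : Continuous G) (hFpos : ∀ θ, 0 < F θ)
    (hGpos : ∀ θ, 0 < G θ) :
    (∫ θ in a..b, F θ ^ (1 - p) * G θ ^ p)
      ≤ (∫ θ in a..b, F θ) ^ (1 - p) * (∫ θ in a..b, G θ) ^ p ∧
    ((∫ θ in a..b, F θ ^ (1 - p) * G θ ^ p)
      = (∫ θ in a..b, F θ) ^ (1 - p) * (∫ θ in a..b, G θ) ^ p →
      ∀ θ ∈ Set.Icc a b, F θ / (∫ θ in a..b, F θ) = G θ / ∫ θ in a..b, G θ) := by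
  have hFi := hF.intervalIntegrable (μ := volume) a b
  have hGi := hG.intervalIntegrable (μ := volume) a b
  set I := ∫ θ in a..b, F θ with hI
  set J := ∫ θ in a..b, G θ with hJ
  have hIpos : 0 < I := intervalIntegral_pos_of_pos hFi hFpos hab
  have hJpos : 0 < J := intervalIntegral_pos_of_pos hGi hGpos hab
  have hC : 0 < I ^ (1 - p) * J ^ p := by positivity
  set f : ℝ → ℝ := fun θ => (F θ / I) ^ (1 - p) * (G θ / J) ^ p with hf
  set g : ℝ → ℝ := fun θ => (1 - p) * (F θ / I) + p * (G θ / J) with hg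
  have hfc : Continuous f :=
    ((hF.div_const I).rpow_const fun θ => .inl (div_pos (hFpos θ) hIpos).ne').mul
      ((hG.div_const J).rpow_const fun θ => .inl (div_pos (hGpos θ) hJpos).ne')
  have hgc : Continuous g := by fun_prop
  have hfg (θ : ℝ) : f θ ≤ g θ := by
    by_cases h : F θ / I = G θ / J
    · simp only [hf, hg, h]
      rw [← Real.rpow_add (div_pos (hGpos θ) hJpos)]
      simp only [sub_add_cancel, Real.rpow_one]
      exact le_of_eq (by ring)
    · exact (rpow_mul_rpow_lt_of_ne hp0 hp1 (div_pos (hFpos θ) hIpos)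
        (div_pos (hGpos θ) hJpos) h).le
  have hgint : ∫ θ in a..b, g θ = 1 := by
    simp only [hg]
    rw [integral_add ((hFi.div_const _).const_mul _) ((hGi.div_const _).const_mul _),
      intervalIntegral.integral_const_mul, intervalIntegral.integral_const_mul,
      intervalIntegral.integral_div, intervalIntegral.integral_div, ← hI, ← hJ,
      div_self hIpos.ne', div_self hJpos.ne']
    ring
  have hfint : ∫ θ in a..b, F θ ^ (1 - p) * G θ ^ p
      = (∫ θ in a..b, f θ) * (I ^ (1 - p) * J ^ p) := by
    rw [← intervalIntegral.integral_mul_const]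
    congr 1
    ext θ
    simp only [hf]
    rw [Real.div_rpow (hFpos θ).le hIpos.le, Real.div_rpow (hGpos θ).le hJpos.le]
    have := (Real.rpow_pos_of_pos hIpos (1 - p)).ne'
    have := (Real.rpow_pos_of_pos hJpos p).ne'
    field_simp
  rw [hfint]
  refine ⟨mul_le_of_le_one_left hC.le (hgint ▸ integral_mono hab.le
    (hfc.intervalIntegrable _ _) (hgc.intervalIntegrable _ _) hfg), fun heq => ?_⟩
  by_contra! hne
  obtain ⟨θ, hθ, hne⟩ := hne
  have hlt := integral_lt_integral_of_continuousOn_of_le_of_exists_lt hab hfc.continuousOn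
    hgc.continuousOn (fun θ _ => hfg θ) ⟨θ, hθ, rpow_mul_rpow_lt_of_ne hp0 hp1
      (div_pos (hFpos θ) hIpos) (div_pos (hGpos θ) hJpos) hne⟩
  rw [hgint] at hlt
  exact (mul_lt_of_lt_one_left hC hlt).ne heq

/-! ### The Ermakov equation -/

/-- Solutions of the Ermakov equation `s'' + s = c / s³`. The energy `E = s'² + s² + c / s²` is
conserved, so `w = s²` solves the linear equation `w'' = 2 E - 4 w` and is the quadratic form in
`(cos θ, sin θ)` with the same initial data. -/
theorem sq_eq_of_mul_pow_three_eq {s s' s'' : ℝ → ℝ} {c : ℝ}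
    (hs : ∀ θ, HasDerivAt s (s' θ) θ) (hs' : ∀ θ, HasDerivAt s' (s'' θ) θ)
    (hpos : ∀ θ, 0 < s θ) (hc : ∀ θ, (s'' θ + s θ) * s θ ^ 3 = c) (θ : ℝ) :
    s θ ^ 2 = (s 0 * Real.cos θ + s' 0 * Real.sin θ) ^ 2 + c / s 0 ^ 2 * Real.sin θ ^ 2 := by
  have hs'' (θ : ℝ) : s'' θ = c / s θ ^ 3 - s θ := by
    have := (hpos θ).ne'
    rw [← hc θ]; field_simp; ring
  set E : ℝ → ℝ := fun θ => s' θ ^ 2 + s θ ^ 2 + c / s θ ^ 2 with hE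
  have hEd (θ : ℝ) : HasDerivAt E 0 θ := by
    have h1 := (((hs' θ).pow 2).add ((hs θ).pow 2)).add
      ((hasDerivAt_const θ c).div ((hs θ).pow 2) (pow_pos (hpos θ) 2).ne')
    refine h1.congr_deriv ?_
    have := (hpos θ).ne'
    rw [hs'']
    simp only [Pi.pow_apply]
    field_simp
    ring
  have hEc (θ : ℝ) : E θ = E 0 :=
    is_const_of_deriv_eq_zero (fun θ => (hEd θ).differentiableAt) (fun θ => (hEd θ).deriv) θ 0
  -- `D` is the difference of both sides and `D₁` its derivative; `D'' = -4 D`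
  set D : ℝ → ℝ := fun θ => s θ ^ 2 - ((s 0 * Real.cos θ + s' 0 * Real.sin θ) ^ 2 +
    c / s 0 ^ 2 * Real.sin θ ^ 2) with hD
  set D₁ : ℝ → ℝ := fun θ => 2 * s θ * s' θ - (2 * (s 0 * Real.cos θ + s' 0 * Real.sin θ) *
    (s' 0 * Real.cos θ - s 0 * Real.sin θ) +
    2 * (c / s 0 ^ 2) * (Real.sin θ * Real.cos θ)) with hD₁
  have hDd (θ : ℝ) : HasDerivAt D (D₁ θ) θ := by
    have h := ((hs θ).pow 2).sub (((((Real.hasDerivAt_cos θ).const_mul (s 0)).add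
      ((Real.hasDerivAt_sin θ).const_mul (s' 0))).pow 2).add
      (((Real.hasDerivAt_sin θ).pow 2).const_mul (c / s 0 ^ 2)))
    refine h.congr_deriv ?_
    simp only [hD₁, Pi.add_apply]
    push_cast
    ring
  have hD₁d (θ : ℝ) : HasDerivAt D₁ (-4 * D θ) θ := by
    have h := (((hs θ).const_mul 2).mul (hs' θ)).sub
      ((((((Real.hasDerivAt_cos θ).const_mul (s 0)).add
      ((Real.hasDerivAt_sin θ).const_mul (s' 0))).const_mul 2).mul
      (((Real.hasDerivAt_cos θ).const_mul (s' 0)).sub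
      ((Real.hasDerivAt_sin θ).const_mul (s 0)))).add
      (((Real.hasDerivAt_sin θ).mul (Real.hasDerivAt_cos θ)).const_mul (2 * (c / s 0 ^ 2))))
    refine h.congr_deriv ?_
    have e := hEc θ
    simp only [hE] at e
    have h0 := (hpos θ).ne'
    have h00 := (hpos 0).ne'
    have e2 : 2 * s θ * s'' θ = 2 * (c / s θ ^ 2) - 2 * s θ ^ 2 := by
      rw [hs'']; field_simp
    have e3 := Real.sin_sq_add_cos_sq θ
    simp only [hD, Pi.add_apply, Pi.sub_apply]
    generalize c / s 0 ^ 2 = d at *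
    generalize Real.sin θ = S at *
    generalize Real.cos θ = C at *
    linear_combination e2 + 2 * e + 2 * (s' 0 ^ 2 + s 0 ^ 2 + d) * (-e3)
  have hQ (θ : ℝ) : HasDerivAt (fun θ => D₁ θ ^ 2 + 4 * D θ ^ 2) 0 θ :=
    (((hD₁d θ).pow 2).add (((hDd θ).pow 2).const_mul 4)).congr_deriv (by push_cast; ring)
  have hQ0 := is_const_of_deriv_eq_zero (fun θ => (hQ θ).differentiableAt)
    (fun θ => (hQ θ).deriv) θ 0
  -- `D₁² + 4 D²` is constant and vanishes at `0`
  have : D₁ 0 = 0 ∧ D 0 = 0 := by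
    constructor <;> simp [hD₁, hD]
  simp only [this.1, this.2] at hQ0
  have : D θ = 0 := by nlinarith [sq_nonneg (D₁ θ), sq_nonneg (D θ)]
  simp only [hD] at this
  linarith

/-! ### Unit normals -/

theorem inner_unitNormal (y : Plane) (θ : ℝ) :
    ⟪y, unitNormal θ⟫ = y 0 * Real.cos θ + y 1 * Real.sin θ := by
  simp [unitNormal, PiLp.inner_apply, Fin.sum_univ_two, mul_comm]

theorem norm_unitNormal (θ : ℝ) : ‖unitNormal θ‖ = 1 := by
  simp [unitNormal, EuclideanSpace.norm_eq, Fin.sum_univ_two]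

theorem unitNormal_add_pi (θ : ℝ) : unitNormal (θ + Real.pi) = -unitNormal θ := by
  ext i
  fin_cases i <;> simp [unitNormal, Real.cos_add_pi, Real.sin_add_pi]

/-- Polar coordinates in the plane, with the angle in `[0, 2π)`. -/
theorem exists_eq_smul_unitNormal (w : Plane) :
    ∃ θ ∈ Set.Ico 0 (2 * Real.pi), w = ‖w‖ • unitNormal θ := by
  set z : ℂ := ⟨w 0, w 1⟩ with hz
  have hn : ‖w‖ = ‖z‖ := by
    rw [EuclideanSpace.norm_eq, Complex.norm_eq_sqrt_sq_add_sq]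
    simp [Fin.sum_univ_two, hz]
  refine ⟨toIcoMod Real.two_pi_pos 0 z.arg,
    by simpa using toIcoMod_mem_Ico Real.two_pi_pos 0 z.arg, ?_⟩
  have hper (f : ℝ → ℝ) (hf : Function.Periodic f (2 * Real.pi)) :
      f (toIcoMod Real.two_pi_pos 0 z.arg) = f z.arg := by
    rw [toIcoMod, hf.sub_zsmul_eq]
  ext i
  fin_cases i
  · simp [unitNormal, hper _ Real.cos_periodic, hn, show w 0 = z.re from rfl]
  · simp [unitNormal, hper _ Real.sin_periodic, hn, show w 1 = z.im from rfl]

/-! ### Support function and Gauss parametrization -/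

section Body

variable {K : Set Plane}

theorem inner_le_supportFunction (hK : IsCompact K) {y : Plane} (hy : y ∈ K) (θ : ℝ) :
    ⟪y, unitNormal θ⟫ ≤ supportFunction K θ :=
  le_csSup (hK.image (by fun_prop)).bddAbove ⟨y, hy, rfl⟩

theorem supportFunction_le (hK : K.Nonempty) {θ c : ℝ} (h : ∀ y ∈ K, ⟪y, unitNormal θ⟫ ≤ c) :
    supportFunction K θ ≤ c :=
  csSup_le (hK.image _) (by rintro _ ⟨y, hy, rfl⟩; exact h y hy)

/-- A compact convex set is the intersection of its supporting half-planes, hence determined by its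
support function. -/
theorem mem_iff_inner_le_supportFunction (hK : IsCompact K) (hc : Convex ℝ K) (hne : K.Nonempty)
    (y : Plane) : y ∈ K ↔ ∀ θ, ⟪y, unitNormal θ⟫ ≤ supportFunction K θ := by
  refine ⟨fun hy θ => inner_le_supportFunction hK hy θ, fun h => ?_⟩
  by_contra hy
  obtain ⟨f, u, hu, hfu⟩ := geometric_hahn_banach_closed_point hc hK.isClosed hy
  obtain ⟨w, rfl⟩ := (InnerProductSpace.toDual ℝ Plane).surjective f
  obtain ⟨θ, -, hθ⟩ := exists_eq_smul_unitNormal w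
  simp only [InnerProductSpace.toDual_apply_apply] at hu hfu
  have e (v : Plane) : ⟪w, v⟫ = ‖w‖ * ⟪v, unitNormal θ⟫ := by
    conv_lhs => rw [hθ]
    rw [real_inner_smul_left, real_inner_comm]
  rcases (norm_nonneg w).eq_or_lt with h0 | h0
  · obtain ⟨a, ha⟩ := hne
    have := hu a ha
    rw [e, ← h0] at this hfu
    linarith
  · have : supportFunction K θ ≤ u / ‖w‖ := supportFunction_le hne fun a ha => by
      rw [le_div_iff₀ h0, mul_comm, ← e]
      exact (hu a ha).le
    have h2 := (h θ).trans this
    rw [le_div_iff₀ h0, mul_comm, ← e] at h2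
    linarith

theorem inner_lt_supportFunction (hK : IsCompact K) {y : Plane} (hy : y ∈ interior K) (θ : ℝ) :
    ⟪y, unitNormal θ⟫ < supportFunction K θ := by
  have ht : Filter.Tendsto (fun t : ℝ => y + t • unitNormal θ) (nhdsWithin 0 (Set.Ioi 0))
      (nhds y) := by
    have : ContinuousAt (fun t : ℝ => y + t • unitNormal θ) 0 := by fun_prop
    simpa [ContinuousAt] using this.tendsto.mono_left nhdsWithin_le_nhds
  obtain ⟨t, htK, ht0⟩ := ((ht.eventually (isOpen_interior.mem_nhds hy)).and
    self_mem_nhdsWithin).exists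
  have h := inner_le_supportFunction hK (interior_subset htK) θ
  rw [inner_add_left, real_inner_smul_left, real_inner_self_eq_norm_sq, norm_unitNormal] at h
  have : (0 : ℝ) < t := ht0
  linarith

namespace IsSmoothSymmetricBody

theorem zero_mem_interior (hK : IsSmoothSymmetricBody K) : (0 : Plane) ∈ interior K := by
  obtain ⟨y, hy⟩ := hK.interior_nonempty
  have h := hK.strictConvex.convex.combo_interior_self_mem_interior hy
    (hK.symmetric y (interior_subset hy)) (a := 1 / 2) (b := 1 / 2) (by norm_num) (by norm_num)
    (by norm_num)
  simpa using h

theorem supportFunction_pos (hK : IsSmoothSymmetricBody K) (θ : ℝ) : 0 < supportFunction K θ := by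
  simpa using inner_lt_supportFunction hK.isCompact hK.zero_mem_interior θ

theorem supportFunction_periodic (hK : IsSmoothSymmetricBody K) :
    Function.Periodic (supportFunction K) Real.pi := by
  have hne : K.Nonempty := hK.interior_nonempty.mono interior_subset
  intro θ
  apply le_antisymm <;> refine supportFunction_le hne fun y hy => ?_
  · simpa [unitNormal_add_pi] using
      inner_le_supportFunction hK.isCompact (hK.symmetric y hy) θ
  · simpa [unitNormal_add_pi] using
      inner_le_supportFunction hK.isCompact (hK.symmetric y hy) (θ + Real.pi)

theorem supportFunction_periodic_two_pi (hK : IsSmoothSymmetricBody K) :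
    Function.Periodic (supportFunction K) (2 * Real.pi) := by
  simpa using hK.supportFunction_periodic.nat_mul 2

/-- The Gauss parametrization reaches every boundary point `y` within one period: `y` has some outer
normal, and by strict convexity it is the only boundary point with that normal. -/
theorem exists_eq_of_mem_frontier (hK : IsSmoothSymmetricBody K) {x : ℝ → Plane}
    (hx : IsGaussParametrization K x) {y : Plane} (hy : y ∈ frontier K) :
    ∃ θ ∈ Set.Ico 0 (2 * Real.pi), x θ = y := by
  have hcl := hK.isCompact.isClosed
  obtain ⟨f, hf⟩ := geometric_hahn_banach_open_point hK.strictConvex.convex.interior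
    isOpen_interior hy.2
  obtain ⟨w, rfl⟩ := (InnerProductSpace.toDual ℝ Plane).surjective f
  obtain ⟨θ, hθ, hw⟩ := exists_eq_smul_unitNormal w
  simp only [InnerProductSpace.toDual_apply_apply] at hf
  have e (v : Plane) : ⟪w, v⟫ = ‖w‖ * ⟪v, unitNormal θ⟫ := by
    conv_lhs => rw [hw]
    rw [real_inner_smul_left, real_inner_comm]
  refine ⟨θ, hθ, ?_⟩
  have hw0 : 0 < ‖w‖ := by
    refine (norm_nonneg w).lt_of_ne fun h0 => ?_
    have := hf 0 hK.zero_mem_interior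
    rw [e, e, ← h0] at this
    linarith
  by_contra hne
  -- the midpoint of two distinct maximizers would be an interior maximizer
  have hm := hK.strictConvex (hcl.frontier_subset (hx θ).1) (hcl.frontier_subset hy) hne
    (a := 1 / 2) (b := 1 / 2) (by norm_num) (by norm_num) (by norm_num)
  have h := hf _ hm
  rw [e, e, mul_lt_mul_iff_right₀ hw0, inner_add_left, real_inner_smul_left,
    real_inner_smul_left] at h
  have := (hx θ).2 y (hcl.frontier_subset hy)
  linarith

end IsSmoothSymmetricBody

theorem IsGaussParametrization.supportFunction_eq (hK : IsCompact K) {x : ℝ → Plane}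
    (hx : IsGaussParametrization K x) (θ : ℝ) : supportFunction K θ = ⟪x θ, unitNormal θ⟫ :=
  have hmem := hK.isClosed.frontier_subset (hx θ).1
  le_antisymm (supportFunction_le ⟨_, hmem⟩ (hx θ).2) (inner_le_supportFunction hK hmem θ)

/-- The derivative of the Gauss parametrization is tangential: `⟨x τ, z θ⟩` is maximal at
`τ = θ`. -/
theorem IsGaussParametrization.inner_deriv_unitNormal (hK : IsCompact K) {x : ℝ → Plane}
    (hx : IsGaussParametrization K x) {θ : ℝ} {v : Plane} (hv : HasDerivAt x v θ) :
    ⟪v, unitNormal θ⟫ = 0 := by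
  have hmax : IsLocalMax (fun τ => ⟪x τ, unitNormal θ⟫) θ :=
    .of_forall fun τ => (hx θ).2 _ (hK.isClosed.frontier_subset (hx τ).1)
  have hd := hv.inner ℝ (hasDerivAt_const θ (unitNormal θ))
  simpa using hmax.hasDerivAt_eq_zero hd

theorem hasDerivAt_coord {x : ℝ → Plane} {v : Plane} {θ : ℝ} (h : HasDerivAt x v θ) (i : Fin 2) :
    HasDerivAt (fun τ => x τ i) (v i) θ :=
  (EuclideanSpace.proj (𝕜 := ℝ) i).hasFDerivAt.comp_hasDerivAt θ h

/-- Differentiating `s = ⟨x, z⟩` twice along the Gauss parametrization `x`: since `x'` is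
tangential, `s' = ⟨x, z'⟩` and `s'' + s = ⟨x', z'⟩`, so that `x' = (s'' + s) z'`. -/
theorem IsGaussParametrization.deriv_eq_radiusOfCurvature_mul (hK : IsCompact K) {x : ℝ → Plane}
    (hx : IsGaussParametrization K x) (hd : Differentiable ℝ x) (θ : ℝ) :
    deriv x θ 0 = -radiusOfCurvature K θ * Real.sin θ ∧
    deriv x θ 1 = radiusOfCurvature K θ * Real.cos θ := by
  have hs : supportFunction K = fun θ => x θ 0 * Real.cos θ + x θ 1 * Real.sin θ := by
    ext θ
    rw [hx.supportFunction_eq hK, inner_unitNormal]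
  have hX (i : Fin 2) (θ : ℝ) : HasDerivAt (fun τ => x τ i) (deriv x θ i) θ :=
    hasDerivAt_coord (hd θ).hasDerivAt i
  have ht (θ : ℝ) : deriv x θ 0 * Real.cos θ + deriv x θ 1 * Real.sin θ = 0 := by
    rw [← inner_unitNormal]
    exact hx.inner_deriv_unitNormal hK (hd θ).hasDerivAt
  have h1 (θ : ℝ) : HasDerivAt (supportFunction K)
      (x θ 1 * Real.cos θ - x θ 0 * Real.sin θ) θ := by
    rw [hs]
    refine (((hX 0 θ).mul (Real.hasDerivAt_cos θ)).add
      ((hX 1 θ).mul (Real.hasDerivAt_sin θ))).congr_deriv ?_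
    linear_combination ht θ
  have hs' : deriv (supportFunction K) =
      fun θ => x θ 1 * Real.cos θ - x θ 0 * Real.sin θ := funext fun θ => (h1 θ).deriv
  have h2 : HasDerivAt (deriv (supportFunction K))
      (deriv x θ 1 * Real.cos θ - deriv x θ 0 * Real.sin θ - supportFunction K θ) θ := by
    rw [hs', hs]
    refine (((hX 1 θ).mul (Real.hasDerivAt_cos θ)).sub
      ((hX 0 θ).mul (Real.hasDerivAt_sin θ))).congr_deriv ?_
    ring
  have hr : radiusOfCurvature K θ =
      deriv x θ 1 * Real.cos θ - deriv x θ 0 * Real.sin θ := by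
    rw [radiusOfCurvature, h2.deriv]
    ring
  refine ⟨?_, ?_⟩ <;> rw [hr]
  · linear_combination Real.cos θ * ht θ - deriv x θ 0 * Real.sin_sq_add_cos_sq θ
  · linear_combination Real.sin θ * ht θ - deriv x θ 1 * Real.sin_sq_add_cos_sq θ

/-- By convexity the radius of curvature is nonnegative, and it vanishes only where `x'` does. -/
theorem IsGaussParametrization.radiusOfCurvature_pos (hK : IsCompact K) {x : ℝ → Plane}
    (hx : IsGaussParametrization K x) (hd : Differentiable ℝ x) {θ : ℝ} (h0 : deriv x θ ≠ 0) :
    0 < radiusOfCurvature K θ := by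
  obtain ⟨e0, e1⟩ := hx.deriv_eq_radiusOfCurvature_mul hK hd θ
  have hne : radiusOfCurvature K θ ≠ 0 := by
    intro h
    apply h0
    ext i
    fin_cases i
    · simpa [h] using e0
    · simpa [h] using e1
  refine hne.symm.lt_of_le ?_
  -- `x` is monotone in the normal: `⟨x τ - x θ, z τ - z θ⟩ ≥ 0`
  set g : ℝ → ℝ := fun τ => slope (fun τ => x τ 0) θ τ * slope Real.cos θ τ +
    slope (fun τ => x τ 1) θ τ * slope Real.sin θ τ with hg
  have hlim : Filter.Tendsto g (nhdsWithin θ {θ}ᶜ) (nhds (radiusOfCurvature K θ)) := by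
    have h := ((hasDerivAt_coord (hd θ).hasDerivAt 0).tendsto_slope.mul
      (Real.hasDerivAt_cos θ).tendsto_slope).add
      ((hasDerivAt_coord (hd θ).hasDerivAt 1).tendsto_slope.mul
      (Real.hasDerivAt_sin θ).tendsto_slope)
    convert h using 2
    rw [e0, e1]
    linear_combination -radiusOfCurvature K θ * Real.sin_sq_add_cos_sq θ
  refine ge_of_tendsto' hlim fun τ => ?_
  have hmem (τ : ℝ) := hK.isClosed.frontier_subset (hx τ).1
  have k1 := (hx θ).2 _ (hmem τ)
  have k2 := (hx τ).2 _ (hmem θ)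
  simp only [inner_unitNormal] at k1 k2
  have : g τ = ((τ - θ)⁻¹) ^ 2 * ((x τ 0 - x θ 0) * (Real.cos τ - Real.cos θ) +
      (x τ 1 - x θ 1) * (Real.sin τ - Real.sin θ)) := by
    simp only [hg, slope_def_field]
    ring
  rw [this]
  exact mul_nonneg (sq_nonneg _) (by linarith)

/-- The support function is twice continuously differentiable, as `s = ⟨x, z⟩` with a smooth Gauss
parametrization `x`, and the radius of curvature is positive. -/
theorem IsSmoothSymmetricBody.supportFunction_regularity (hK : IsSmoothSymmetricBody K) :
    (∀ θ, HasDerivAt (supportFunction K) (deriv (supportFunction K) θ) θ) ∧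
    (∀ θ, HasDerivAt (deriv (supportFunction K)) (deriv (deriv (supportFunction K)) θ) θ) ∧
    Continuous (deriv (deriv (supportFunction K))) ∧ ∀ θ, 0 < radiusOfCurvature K θ := by
  obtain ⟨x, hx, hsm, hd0, -⟩ := hK.smoothly_embedded
  have hd : Differentiable ℝ x := hsm.differentiable (by simp)
  have hs : ContDiff ℝ 2 (supportFunction K) := by
    have e : supportFunction K = fun θ => x θ 0 * Real.cos θ + x θ 1 * Real.sin θ := by
      ext θ
      rw [hx.supportFunction_eq hK.isCompact, inner_unitNormal]
    have hX (i : Fin 2) : ContDiff ℝ 2 fun θ => x θ i :=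
      (EuclideanSpace.proj (𝕜 := ℝ) i).contDiff.comp (contDiff_infty.1 hsm 2)
    rw [e]
    exact ((hX 0).mul Real.contDiff_cos).add ((hX 1).mul Real.contDiff_sin)
  have h1 : ContDiff ℝ 1 (deriv (supportFunction K)) := hs.deriv'
  have h2 : Continuous (deriv (deriv (supportFunction K))) := h1.continuous_deriv le_rfl
  exact ⟨fun θ => (hs.differentiable (by simp) θ).hasDerivAt,
    fun θ => (h1.differentiable (by simp) θ).hasDerivAt, h2,
    fun θ => hx.radiusOfCurvature_pos hK.isCompact hd (hd0 θ)⟩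

/-! ### The area formula -/

theorem gauge_gaussParametrization (hK : IsSmoothSymmetricBody K) {x : ℝ → Plane}
    (hx : IsGaussParametrization K x) (θ : ℝ) : gauge K (x θ) = 1 :=
  (gauge_eq_one_iff_mem_frontier hK.strictConvex.convex
    (mem_interior_iff_mem_nhds.1 hK.zero_mem_interior)).2 (hx θ).1

/-- The cone map `(t, θ) ↦ t x(θ)` parametrizes the punctured body bijectively. -/
theorem bijOn_smul_gaussParametrization (hK : IsSmoothSymmetricBody K) {x : ℝ → Plane}
    (hx : IsGaussParametrization K x) (hinj : Set.InjOn x (Set.Ico 0 (2 * Real.pi))) :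
    Set.BijOn (fun p : ℝ × ℝ => p.1 • x p.2) (Set.Ioc 0 1 ×ˢ Set.Ico 0 (2 * Real.pi))
      (K \ {0}) := by
  have hc := hK.strictConvex.convex
  have h0 := mem_interior_iff_mem_nhds.1 hK.zero_mem_interior
  have hg := gauge_gaussParametrization hK hx
  have hcl := hK.isCompact.isClosed
  have hpos {y : Plane} : 0 < gauge K y ↔ y ≠ 0 :=
    gauge_pos (absorbent_nhds_zero h0) (NormedSpace.isVonNBounded_iff ℝ |>.2 hK.isCompact.isBounded)
  have hgs {t : ℝ} (ht : 0 < t) (θ : ℝ) : gauge K (t • x θ) = t := by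
    rw [gauge_smul_of_nonneg ht.le, hg, smul_eq_mul, mul_one]
  refine ⟨?_, ?_, ?_⟩
  · rintro ⟨t, θ⟩ ⟨⟨ht0, ht1⟩, -⟩
    refine ⟨?_, ?_⟩
    · rw [← hcl.closure_eq, ← gauge_le_one_iff_mem_closure hc h0, hgs ht0]
      exact ht1
    · exact hpos.1 (by rw [hgs ht0]; exact ht0)
  · rintro ⟨t, θ⟩ ⟨⟨ht0, -⟩, hθ⟩ ⟨t', θ'⟩ ⟨⟨ht0', -⟩, hθ'⟩ h
    have ht : t = t' := (hgs ht0 θ).symm.trans ((congrArg (gauge K) h).trans (hgs ht0' θ'))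
    subst ht
    exact Prod.ext rfl (hinj hθ hθ' (smul_right_injective _ ht0.ne' h))
  · rintro y ⟨hy, hy0⟩
    have ht := hpos.2 hy0
    have hf : (gauge K y)⁻¹ • y ∈ frontier K := by
      rw [← gauge_eq_one_iff_mem_frontier hc h0, gauge_smul_of_nonneg (inv_nonneg.2 ht.le),
        smul_eq_mul, inv_mul_cancel₀ ht.ne']
    obtain ⟨θ, hθ, e⟩ := hK.exists_eq_of_mem_frontier hx hf
    refine ⟨(gauge K y, θ), ⟨⟨ht, gauge_le_one_of_mem hy⟩, hθ⟩, ?_⟩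
    simp only [e]
    rw [smul_inv_smul₀ ht.ne']

/-- The classical formula `A(K) = ½ ∫ s (s'' + s) dθ`: the cone map `(t, θ) ↦ t x(θ)` has Jacobian
`t s (s'' + s)`. -/
theorem area_eq (hK : IsSmoothSymmetricBody K) :
    area K = 1 / 2 * ∫ θ in (0 : ℝ)..(2 * Real.pi),
      supportFunction K θ * radiusOfCurvature K θ := by
  obtain ⟨x, hx, hsm, hd0, hinj⟩ := hK.smoothly_embedded
  have hd : Differentiable ℝ x := hsm.differentiable (by simp)
  have hX (i : Fin 2) (θ : ℝ) : HasDerivAt (fun τ => x τ i) (deriv x θ i) θ :=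
    hasDerivAt_coord (hd θ).hasDerivAt i
  have hmp : MeasurePreserving
      ((MeasurableEquiv.toLp 2 (Fin 2 → ℝ)).symm.trans MeasurableEquiv.finTwoArrow) volume volume :=
    (volume_preserving_finTwoArrow ℝ).comp (PiLp.volume_preserving_ofLp (Fin 2))
  set E := (MeasurableEquiv.toLp 2 (Fin 2 → ℝ)).symm.trans MeasurableEquiv.finTwoArrow with hE
  set S : Set (ℝ × ℝ) := Set.Ioc 0 1 ×ˢ Set.Ico 0 (2 * Real.pi) with hS
  set f : ℝ × ℝ → ℝ × ℝ := fun p => (p.1 * x p.2 0, p.1 * x p.2 1) with hf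
  have hfE : f = E ∘ fun p : ℝ × ℝ => p.1 • x p.2 := by
    ext p <;> simp [hf, hE, MeasurableEquiv.finTwoArrow]
  have hbij := bijOn_smul_gaussParametrization hK hx hinj
  have harea : area K = volume.real (f '' S) := by
    rw [hfE, Set.image_comp, hbij.image_eq, MeasurableEquiv.image_eq_preimage_symm, Measure.real,
      (hmp.symm E).measure_preimage_equiv, area, Measure.real,
      measure_sdiff_null (measure_singleton 0)]
  set f' : ℝ × ℝ → (ℝ × ℝ →L[ℝ] ℝ × ℝ) := fun p => LinearMap.toContinuousLinearMap
    (Matrix.toLin (Module.Basis.finTwoProd ℝ) (Module.Basis.finTwoProd ℝ)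
      !![x p.2 0, p.1 * deriv x p.2 0; x p.2 1, p.1 * deriv x p.2 1]) with hf'
  have hderiv (p : ℝ × ℝ) : HasFDerivAt f (f' p) p := by
    simp only [hf']
    rw [Matrix.toLin_finTwoProd_toContinuousLinearMap]
    have h (i : Fin 2) := (hasFDerivAt_fst (𝕜 := ℝ) (p := p)).mul
      ((hX i p.2).comp_hasFDerivAt p (hasFDerivAt_snd (𝕜 := ℝ) (p := p)))
    convert! (h 0).prodMk (h 1) using 2 <;>
    · ext <;> simp [mul_comm]
  have hdet (p : ℝ × ℝ) : (f' p).det =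
      p.1 * (supportFunction K p.2 * radiusOfCurvature K p.2) := by
    obtain ⟨e0, e1⟩ := hx.deriv_eq_radiusOfCurvature_mul hK.isCompact hd p.2
    have : (f' p).det = x p.2 0 * (p.1 * deriv x p.2 1) - p.1 * deriv x p.2 0 * x p.2 1 := by
      conv_lhs => rw [hf']
      rw [ContinuousLinearMap.det, LinearMap.coe_toContinuousLinearMap, LinearMap.det_toLin,
        Matrix.det_fin_two_of]
    rw [this, e0, e1, hx.supportFunction_eq hK.isCompact, inner_unitNormal]
    ring
  have hSm : MeasurableSet S := measurableSet_Ioc.prod measurableSet_Ico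
  have hfinj : Set.InjOn f S := by
    rw [hfE]
    exact E.injective.comp_injOn hbij.injOn
  have key := integral_image_eq_integral_abs_det_fderiv_smul volume hSm
    (fun p _ => (hderiv p).hasFDerivWithinAt) hfinj (fun _ => (1 : ℝ))
  rw [setIntegral_const, smul_eq_mul, mul_one, ← harea] at key
  rw [key]
  have hpos (p : ℝ × ℝ) (hp : p ∈ S) : |(f' p).det| • (1 : ℝ) =
      p.1 * (supportFunction K p.2 * radiusOfCurvature K p.2) := by
    rw [hdet, smul_eq_mul, mul_one, abs_of_nonneg]
    exact mul_nonneg hp.1.1.le (mul_pos (hK.supportFunction_pos _)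
      (hx.radiusOfCurvature_pos hK.isCompact hd (hd0 _))).le
  rw [setIntegral_congr_fun hSm hpos, hS, Measure.volume_eq_prod,
    setIntegral_prod_mul (fun t : ℝ => t) (fun θ => supportFunction K θ * radiusOfCurvature K θ),
    ← integral_of_le zero_le_one, integral_id, integral_Ico_eq_integral_Ioc,
    ← integral_of_le (by positivity)]
  norm_num

end Body

/-! ### Ellipses -/

theorem map_eq_smul_add_smul (T : Plane →ₗ[ℝ] Plane) (y : Plane) :
    T y = y 0 • T !₂[1, 0] + y 1 • T !₂[0, 1] := by
  rw [← map_smul, ← map_smul, ← map_add]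
  congr 1
  ext i
  fin_cases i <;> simp

/-- The squared support function of the ellipse `T B` is `|Tᵀ z|²`, written out by means of the
columns of `T`. -/
theorem supportFunction_image_closedBall_sq (T : Plane →ₗ[ℝ] Plane) (θ : ℝ) :
    supportFunction (T '' Metric.closedBall 0 1) θ ^ 2 =
      ⟪T !₂[1, 0], unitNormal θ⟫ ^ 2 + ⟪T !₂[0, 1], unitNormal θ⟫ ^ 2 := by
  set m : Plane := !₂[⟪T !₂[1, 0], unitNormal θ⟫, ⟪T !₂[0, 1], unitNormal θ⟫] with hm
  -- `m` is `Tᵀ z`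
  have hin (y : Plane) : ⟪T y, unitNormal θ⟫ = ⟪y, m⟫ := by
    rw [map_eq_smul_add_smul T y, inner_add_left, real_inner_smul_left, real_inner_smul_left]
    simp [hm, PiLp.inner_apply, Fin.sum_univ_two, mul_comm]
  have hcomp : IsCompact (T '' Metric.closedBall 0 1) :=
    (isCompact_closedBall 0 1).image T.continuous_of_finiteDimensional
  have hs : supportFunction (T '' Metric.closedBall 0 1) θ = ‖m‖ := by
    apply le_antisymm
    · refine supportFunction_le (Set.Nonempty.image T ⟨0, by simp⟩) ?_
      rintro _ ⟨y, hy, rfl⟩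
      rw [hin]
      refine (real_inner_le_norm _ _).trans (mul_le_of_le_one_left (norm_nonneg _) ?_)
      simpa using hy
    · have hmem : ‖m‖⁻¹ • m ∈ Metric.closedBall (0 : Plane) 1 := by
        simpa [norm_smul] using inv_mul_le_one
      have h := inner_le_supportFunction hcomp (Set.mem_image_of_mem T hmem) θ
      rw [hin, real_inner_smul_left, real_inner_self_eq_norm_sq] at h
      rcases eq_or_ne ‖m‖ 0 with h0 | h0
      · simpa [h0] using h
      · rwa [pow_two, inv_mul_cancel_left₀ h0] at h
  rw [hs, EuclideanSpace.norm_sq_eq]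
  simp [hm, Fin.sum_univ_two]

theorem area_image_closedBall (T : Plane →ₗ[ℝ] Plane) :
    area (T '' Metric.closedBall 0 1) =
      Real.pi * |T !₂[1, 0] 0 * T !₂[0, 1] 1 - T !₂[1, 0] 1 * T !₂[0, 1] 0| := by
  have hdet : LinearMap.det T =
      T !₂[1, 0] 0 * T !₂[0, 1] 1 - T !₂[1, 0] 1 * T !₂[0, 1] 0 := by
    have e0 : EuclideanSpace.single (0 : Fin 2) (1 : ℝ) = !₂[1, 0] := by
      ext i; fin_cases i <;> simp
    have e1 : EuclideanSpace.single (1 : Fin 2) (1 : ℝ) = !₂[0, 1] := by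
      ext i; fin_cases i <;> simp
    rw [← LinearMap.det_toMatrix (EuclideanSpace.basisFun (Fin 2) ℝ).toBasis, Matrix.det_fin_two]
    simp [LinearMap.toMatrix_apply, e0, e1]
    ring
  rw [area, Measure.real, Measure.addHaar_image_linearMap, hdet,
    EuclideanSpace.volume_closedBall_fin_two]
  simp [ENNReal.toReal_ofReal, Real.pi_nonneg, mul_comm]

/-- An ellipse has constant centro-affine curvature: `(s'' + s) s³` is the constant `(A / π)²`. -/
theorem radiusOfCurvature_mul_of_isCenteredEllipse {K : Set Plane}
    (hK : IsSmoothSymmetricBody K) (hE : IsCenteredEllipse K) (θ : ℝ) :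
    radiusOfCurvature K θ * supportFunction K θ ^ 3 = (area K / Real.pi) ^ 2 := by
  obtain ⟨T, rfl⟩ := hE
  have hA := area_image_closedBall T.toLinearMap
  have hS := supportFunction_image_closedBall_sq T.toLinearMap
  obtain ⟨h1, h2, -, -⟩ := hK.supportFunction_regularity
  have hpos := hK.supportFunction_pos
  simp only [LinearEquiv.coe_coe] at hA hS
  rw [hA, mul_div_cancel_left₀ _ Real.pi_ne_zero, sq_abs, radiusOfCurvature]
  simp only [inner_unitNormal] at hS
  generalize supportFunction (T '' Metric.closedBall 0 1) = s at *
  generalize T !₂[1, 0] 0 = a at *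
  generalize T !₂[1, 0] 1 = b at *
  generalize T !₂[0, 1] 0 = c at *
  generalize T !₂[0, 1] 1 = d at *
  -- differentiate `s²`, a trigonometric polynomial, twice
  have k (α β θ : ℝ) : HasDerivAt (fun θ => α * Real.cos θ + β * Real.sin θ)
      (β * Real.cos θ + -α * Real.sin θ) θ :=
    (((Real.hasDerivAt_cos θ).const_mul α).add ((Real.hasDerivAt_sin θ).const_mul β)).congr_deriv
      (by ring)
  have d1 (θ : ℝ) : s θ * deriv s θ =
      (a * Real.cos θ + b * Real.sin θ) * (b * Real.cos θ + -a * Real.sin θ) +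
      (c * Real.cos θ + d * Real.sin θ) * (d * Real.cos θ + -c * Real.sin θ) := by
    have e1 := (h1 θ).pow 2
    have e2 := ((k a b θ).pow 2).add ((k c d θ).pow 2)
    have e := e1.unique (e2.congr_of_eventuallyEq (.of_forall hS))
    push_cast at e
    linear_combination e / 2
  have d2 : deriv s θ ^ 2 + s θ * deriv (deriv s) θ =
      (b * Real.cos θ + -a * Real.sin θ) ^ 2 + (d * Real.cos θ + -c * Real.sin θ) ^ 2 - s θ ^ 2 := by
    have e1 := (h1 θ).mul (h2 θ)
    have e2 := ((k a b θ).mul (k b (-a) θ)).add ((k c d θ).mul (k d (-c) θ))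
    have e := e1.unique (e2.congr_of_eventuallyEq (.of_forall d1))
    rw [hS]
    linear_combination e
  have e1 := d1 θ
  have e0 := hS θ
  have e3 := Real.sin_sq_add_cos_sq θ
  have hs4 : (deriv (deriv s) θ + s θ) * s θ ^ 3 =
      s θ ^ 2 * (deriv s θ ^ 2 + s θ * deriv (deriv s) θ + s θ ^ 2) - (s θ * deriv s θ) ^ 2 := by
    ring
  rw [hs4, d2, e1, sub_add_cancel, e0]
  generalize Real.sin θ = S at *
  generalize Real.cos θ = C at *
  have : S ^ 2 = 1 - C ^ 2 := by linarith
  have h4 : S ^ 4 = (1 - C ^ 2) ^ 2 := by rw [← this]; ring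
  ring_nf
  rw [this, h4]
  ring

/-- A body of constant centro-affine curvature is a centered ellipse: its squared support function
is a positive definite quadratic form in the normal, and the support function determines it. -/
theorem isCenteredEllipse_of_radiusOfCurvature_mul {K : Set Plane}
    (hK : IsSmoothSymmetricBody K) {c : ℝ}
    (hc : ∀ θ, radiusOfCurvature K θ * supportFunction K θ ^ 3 = c) : IsCenteredEllipse K := by
  obtain ⟨h1, h2, -, hr⟩ := hK.supportFunction_regularity
  have hpos := hK.supportFunction_pos
  have hsq := sq_eq_of_mul_pow_three_eq h1 h2 hpos hc
  have hc0 : 0 < c := hc 0 ▸ mul_pos (hr 0) (pow_pos (hpos 0) 3)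
  set a := supportFunction K 0 with ha
  set b := deriv (supportFunction K) 0
  have ha0 : a ≠ 0 := (hpos 0).ne'
  set d := √c / a with hd
  have hd2 : d ^ 2 = c / a ^ 2 := by rw [hd, div_pow, Real.sq_sqrt hc0.le]
  have hd0 : d ≠ 0 := div_ne_zero (Real.sqrt_pos.2 hc0).ne' ha0
  -- `|Tᵀ z|² = (a cos θ + b sin θ)² + (d sin θ)²`, the quadratic form found for `s²`
  let T : Plane ≃ₗ[ℝ] Plane :=
    { toFun := fun v => !₂[a * v 0, b * v 0 + d * v 1]
      invFun := fun v => !₂[v 0 / a, (v 1 - b * (v 0 / a)) / d]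
      map_add' := fun v w => by
        ext i; fin_cases i <;> simp <;> ring
      map_smul' := fun t v => by
        ext i; fin_cases i <;> simp <;> ring
      left_inv := fun v => by
        ext i; fin_cases i
        · simp; field_simp
        · simp; field_simp; ring
      right_inv := fun v => by
        ext i; fin_cases i
        · simp; field_simp
        · simp; field_simp; ring }
  refine ⟨T, ?_⟩
  have hTc : IsCompact (T '' Metric.closedBall 0 1) :=
    (isCompact_closedBall 0 1).image T.toLinearMap.continuous_of_finiteDimensional
  have hTconv : Convex ℝ (T '' Metric.closedBall 0 1) :=
    (convex_closedBall 0 1).linear_image T.toLinearMap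
  have h0 : (0 : Plane) ∈ T '' Metric.closedBall 0 1 := ⟨0, by simp, map_zero T⟩
  have heq (θ : ℝ) : supportFunction K θ = supportFunction (T '' Metric.closedBall 0 1) θ := by
    have hn : 0 ≤ supportFunction (T '' Metric.closedBall 0 1) θ := by
      simpa using inner_le_supportFunction hTc h0 θ
    refine (sq_eq_sq₀ (hpos θ).le hn).1 ?_
    have := supportFunction_image_closedBall_sq T.toLinearMap θ
    simp only [LinearEquiv.coe_coe] at this
    rw [this, hsq, ← hd2]
    simp [T, inner_unitNormal]
    ring
  ext y
  rw [mem_iff_inner_le_supportFunction hK.isCompact hK.strictConvex.convex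
    (hK.interior_nonempty.mono interior_subset), mem_iff_inner_le_supportFunction hTc hTconv ⟨0, h0⟩]
  simp only [heq]

/-! ### The affine length and its bounds -/

/-- The integrand of the affine length is a weighted geometric mean of `s (s'' + s)` and `s⁻²`. -/
theorem affineLength_eq {K : Set Plane} (hK : IsSmoothSymmetricBody K) {l : ℝ} :
    affineLength l K = ∫ θ in (0 : ℝ)..(2 * Real.pi),
      (supportFunction K θ * radiusOfCurvature K θ) ^ (1 - l / (l + 2)) *
        ((supportFunction K θ ^ 2)⁻¹) ^ (l / (l + 2)) := by
  obtain ⟨-, -, -, hr⟩ := hK.supportFunction_regularity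
  unfold affineLength
  congr 1
  ext θ
  have hs := hK.supportFunction_pos θ
  have hr := hr θ
  have e : curvature K θ / supportFunction K θ ^ 3 =
      (supportFunction K θ ^ 2)⁻¹ / (supportFunction K θ * radiusOfCurvature K θ) := by
    rw [curvature]
    field_simp
  rw [e, Real.div_rpow (by positivity) (by positivity), Real.rpow_sub (by positivity),
    Real.rpow_one, curvature]
  field_simp

/-- The centered polar body of `K` has area `½ ∫ s⁻² dθ`, so this is the Blaschke–Santaló
inequality. -/
theorem two_mul_area_mul_integral_inv_sq_le {K : Set Plane} (hK : IsSmoothSymmetricBody K) :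
    2 * area K * ∫ θ in (0 : ℝ)..(2 * Real.pi), (supportFunction K θ ^ 2)⁻¹
      ≤ 4 * Real.pi ^ 2 := by
  obtain ⟨h1, h2, h3, -⟩ := hK.supportFunction_regularity
  have hper2 := hK.supportFunction_periodic_two_pi
  have hc' : Continuous (deriv (supportFunction K)) :=
    continuous_iff_continuousAt.2 fun θ => (h2 θ).continuousAt
  have hA := area_eq hK
  have e0 : supportFunction K (2 * Real.pi) = supportFunction K 0 := by
    simpa using hper2 0
  have e1 : deriv (supportFunction K) (2 * Real.pi) = deriv (supportFunction K) 0 := by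
    have := deriv_comp_add_const (supportFunction K) (2 * Real.pi) 0
    rw [zero_add] at this
    rw [← this, funext hper2]
  have hI := integral_mul_add_eq_integral_sq_sub_sq h1 h2 h3 e0 e1
  have : 2 * area K = ∫ θ in (0 : ℝ)..(2 * Real.pi),
      (supportFunction K θ ^ 2 - deriv (supportFunction K) θ ^ 2) := by
    rw [hA, ← hI]
    simp only [radiusOfCurvature]
    ring
  rw [this]
  exact integral_sq_sub_sq_mul_integral_inv_sq_le h1 hc' hK.supportFunction_pos
    hK.supportFunction_periodic

theorem area_pos {K : Set Plane} (hK : IsSmoothSymmetricBody K) : 0 < area K :=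
  ENNReal.toReal_pos (Measure.measure_pos_of_nonempty_interior _ hK.interior_nonempty).ne'
    hK.isCompact.measure_lt_top.ne

/-- The power of the Hölder bound that occurs in the affine isoperimetric ratio. -/
theorem rpow_mul_rpow_rpow_div_rpow {l A G : ℝ} (hl : 0 < l) (hA : 0 < A) (hG : 0 < G) :
    ((2 * A) ^ (1 - l / (l + 2)) * G ^ (l / (l + 2))) ^ (2 + l) / A ^ (2 - l) =
      4 * (A * G) ^ l := by
  have e1 : (1 - l / (l + 2)) * (2 + l) = 2 := by field_simp; ring
  have e2 : l / (l + 2) * (2 + l) = l := by field_simp; ring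
  rw [Real.mul_rpow (by positivity) (by positivity), ← Real.rpow_mul (by positivity),
    ← Real.rpow_mul hG.le, e1, e2, Real.rpow_sub hA, Real.mul_rpow hA.le hG.le,
    Real.rpow_two, Real.rpow_two]
  field_simp
  ring

theorem two_rpow_mul_pi_rpow (l : ℝ) :
    (2 : ℝ) ^ (l + 2) * Real.pi ^ (2 * l) = 4 * (2 * Real.pi ^ 2) ^ l := by
  rw [Real.rpow_add two_pos, Real.mul_rpow two_pos.le (by positivity), ← Real.rpow_natCast_mul
    Real.pi_nonneg]
  norm_num
  ring


end CentroAffine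

open CentroAffine MeasureTheory in
theorem mainTheorem8 (l : ℝ) (hl : 1 ≤ l) (K : Set CentroAffine.Plane)
    (hK : CentroAffine.IsSmoothSymmetricBody K) :
    CentroAffine.affineLength l K ^ (2 + l) / CentroAffine.area K ^ (2 - l)
        ≤ (2 : ℝ) ^ (l + 2) * Real.pi ^ (2 * l) ∧
      (CentroAffine.affineLength l K ^ (2 + l) / CentroAffine.area K ^ (2 - l)
          = (2 : ℝ) ^ (l + 2) * Real.pi ^ (2 * l) ↔
        CentroAffine.IsCenteredEllipse K) := by
  have hl0 : 0 < l := by linarith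
  obtain ⟨h1, h2, h3, hr⟩ := hK.supportFunction_regularity
  have hs := hK.supportFunction_pos
  have hA := area_pos hK
  have hp0 : 0 < l / (l + 2) := by positivity
  have hp1 : l / (l + 2) < 1 := by rw [div_lt_one (by positivity)]; linarith
  have hsc : Continuous (supportFunction K) :=
    continuous_iff_continuousAt.2 fun θ => (h1 θ).continuousAt
  have hrc : Continuous (radiusOfCurvature K) := h3.add hsc
  set F : ℝ → ℝ := fun θ => supportFunction K θ * radiusOfCurvature K θ with hF
  set g : ℝ → ℝ := fun θ => (supportFunction K θ ^ 2)⁻¹ with hg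
  have hFc : Continuous F := hsc.mul hrc
  have hgc : Continuous g := (hsc.pow 2).inv₀ fun θ => (pow_pos (hs θ) 2).ne'
  have hFpos (θ : ℝ) : 0 < F θ := mul_pos (hs θ) (hr θ)
  have hgpos (θ : ℝ) : 0 < g θ := inv_pos.2 (pow_pos (hs θ) 2)
  have hΩ : affineLength l K = ∫ θ in (0 : ℝ)..(2 * Real.pi),
      F θ ^ (1 - l / (l + 2)) * g θ ^ (l / (l + 2)) := affineLength_eq hK
  obtain ⟨hle, heq⟩ := integral_rpow_mul_rpow_le hp0 hp1 Real.two_pi_pos hFc hgc hFpos hgpos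
  have hFA : ∫ θ in (0 : ℝ)..(2 * Real.pi), F θ = 2 * area K := by
    rw [area_eq hK]; ring
  have hG : 0 < ∫ θ in (0 : ℝ)..(2 * Real.pi), g θ :=
    intervalIntegral.intervalIntegral_pos_of_pos (hgc.intervalIntegrable _ _) hgpos
      Real.two_pi_pos
  have hsan : 2 * area K * ∫ θ in (0 : ℝ)..(2 * Real.pi), g θ ≤ 4 * Real.pi ^ 2 :=
    two_mul_area_mul_integral_inv_sq_le hK
  have hΩ0 : 0 ≤ affineLength l K := by
    rw [hΩ]
    refine intervalIntegral.integral_nonneg Real.two_pi_pos.le fun θ _ => ?_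
    exact mul_nonneg (Real.rpow_nonneg (hFpos θ).le _) (Real.rpow_nonneg (hgpos θ).le _)
  rw [← hΩ, hFA] at hle heq
  set G := ∫ θ in (0 : ℝ)..(2 * Real.pi), g θ with hGdef
  have hAl : 0 < area K ^ (2 - l) := Real.rpow_pos_of_pos hA _
  have hbound : 4 * (area K * G) ^ l ≤ 4 * (2 * Real.pi ^ 2) ^ l := by
    have : area K * G ≤ 2 * Real.pi ^ 2 := by linarith
    gcongr
  rw [two_rpow_mul_pi_rpow]
  have hmain : affineLength l K ^ (2 + l) / area K ^ (2 - l) ≤ 4 * (area K * G) ^ l := by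
    rw [← rpow_mul_rpow_rpow_div_rpow hl0 hA hG]
    gcongr
  refine ⟨hmain.trans hbound, fun h => ?_, fun hE => ?_⟩
  · -- equality forces equality in Hölder's inequality, so `s (s'' + s)` is proportional to `s⁻²`
    have hHolder : affineLength l K = (2 * area K) ^ (1 - l / (l + 2)) * G ^ (l / (l + 2)) := by
      refine hle.antisymm (not_lt.1 fun hlt => ?_)
      have : affineLength l K ^ (2 + l) / area K ^ (2 - l) < 4 * (area K * G) ^ l := by
        rw [← rpow_mul_rpow_rpow_div_rpow hl0 hA hG]
        gcongr
      linarith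
    have hprop := heq hHolder
    refine isCenteredEllipse_of_radiusOfCurvature_mul hK (c := 2 * area K / G) fun θ => ?_
    have hper : Function.Periodic (fun θ => radiusOfCurvature K θ * supportFunction K θ ^ 3)
        (2 * Real.pi) := by
      have hp := hK.supportFunction_periodic_two_pi
      have hp' : Function.Periodic (deriv (supportFunction K)) (2 * Real.pi) := fun τ => by
        rw [← deriv_comp_add_const, funext hp]
      have hp'' : Function.Periodic (deriv (deriv (supportFunction K))) (2 * Real.pi) := fun τ => by
        rw [← deriv_comp_add_const, funext hp']
      intro τ
      simp only [radiusOfCurvature, hp τ, hp'' τ]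
    obtain ⟨τ, hτ, e⟩ := hper.exists_mem_Ico₀ Real.two_pi_pos θ
    rw [e]
    have := hprop τ (Set.Ico_subset_Icc_self hτ)
    simp only [hF, hg] at this
    have hsτ := hs τ
    field_simp at this ⊢
    linarith
  · -- for an ellipse `F` is a constant multiple of `g`, so Hölder's inequality is an equality
    have hk : 0 < (area K / Real.pi) ^ 2 := by positivity
    have hFg (θ : ℝ) : F θ = (area K / Real.pi) ^ 2 * g θ := by
      have := hs θ
      rw [← radiusOfCurvature_mul_of_isCenteredEllipse hK hE θ]
      simp only [hF, hg]
      field_simp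
    have h2A : 2 * area K = (area K / Real.pi) ^ 2 * G := by
      rw [← hFA, hGdef, ← intervalIntegral.integral_const_mul]
      simp only [hFg]
    have hHolder : affineLength l K = (2 * area K) ^ (1 - l / (l + 2)) * G ^ (l / (l + 2)) := by
      have hsplit {t : ℝ} (ht : 0 < t) : ((area K / Real.pi) ^ 2 * t) ^ (1 - l / (l + 2)) *
          t ^ (l / (l + 2)) = ((area K / Real.pi) ^ 2) ^ (1 - l / (l + 2)) * t := by
        rw [Real.mul_rpow hk.le ht.le, mul_assoc, ← Real.rpow_add ht, sub_add_cancel,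
          Real.rpow_one]
      rw [h2A, hsplit hG, hΩ, hGdef, ← intervalIntegral.integral_const_mul]
      congr 1
      ext θ
      rw [hFg, hsplit (hgpos θ)]
    have hAG : area K * G = 2 * Real.pi ^ 2 := by
      field_simp at h2A
      linarith
    rw [hHolder, rpow_mul_rpow_rpow_div_rpow hl0 hA hG, hAG]
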